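/- A proper coloring of a finite simple graph $G$ with $k$ colors is a map $f:V(G)\to\{1,\dots,k\}$ with $f(u)\neq f(v)$ for every edge $uv$. It is a locally identifying coloring (lid-coloring) if, in addition, $f(N[u])\neq f(N[v])$ for every pair of adjacent vertices $u,v$ with $N[u]\neq N[v]$, where $N[w]$ denotes the closed neighborhood of $w$. Let $\chi_{lid}(G)$ be the smallest $k$ such that $G$ has a lid-coloring with $k$ colors. Let $C_n$ be the cycle on $n$ vertices, and let $\square$ denote the Cartesian product of graphs. Theorem. Let $m$ and $n$ be positive integers with $3\le m\le n$. Then \[ \chi_{lid}(C_m\square C_n)= \begin{cases} 5 & \text{if } m=3,\\ 3 & \text{if } m \text{ and } n \text{ are both even},\\ 4 & \text{otherwise.} \end{cases} \] -/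

import Mathlib

namespace LidColoring

/-- The closed neighborhood `N[v]` of a vertex: `v` together with all its neighbors. -/
def closedNeighborSet {V : Type*} (G : SimpleGraph V) (v : V) : Set V :=
  insert v (G.neighborSet v)

/-- A proper coloring `C` (properness is part of `SimpleGraph.Coloring`) is locally identifying if
any two adjacent vertices with distinct closed neighborhoods have distinct sets of colors in their
closed neighborhoods. -/
def IsLocallyIdentifying {V α : Type*} {G : SimpleGraph V} (C : G.Coloring α) : Prop :=
  ∀ u v : V, G.Adj u v → closedNeighborSet G u ≠ closedNeighborSet G v →
    C '' closedNeighborSet G u ≠ C '' closedNeighborSet G v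

/-- `G` has a locally identifying coloring with `k` colors. -/
def LidColorable {V : Type*} (G : SimpleGraph V) (k : ℕ) : Prop :=
  ∃ C : G.Coloring (Fin k), IsLocallyIdentifying C

/-- The locally identifying chromatic number: the least `k` such that `G` has a locally identifying
coloring with `k` colors, and `⊤` if there is no such `k`. -/
noncomputable def lidChromaticNumber {V : Type*} (G : SimpleGraph V) : ℕ∞ :=
  ⨅ (k : ℕ) (_ : LidColorable G k), (k : ℕ∞)

end LidColoring

/-!
The lower bounds are local. In a product of two graphs without isolated vertices, adjacent vertices
have different closed neighborhoods, so a locally identifying coloring must give them different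
color sets. The color set of any vertex of a clique `s` lies between the colors of `s` and the set
of all `k` colors, which leaves `2 ^ (k - |s|)` possibilities (`card_le_two_pow_of_isClique`). An
edge therefore forces `k ≥ 3`, and a triangle, present when `m = 3`, forces `k ≥ 5`. With exactly
three colors, the vertices whose color set is full form one side of a bipartition
(`colorable_two_of_lidColorable_three`), which an odd cycle rules out.

The colorings realizing these bounds have the form `(i, j) ↦ F (σ i) (τ j)`, where `F` is a small
fixed table and `σ`, `τ` are closed walks in small digraphs whose vertices index the rows and the
columns of `F`. Being a locally identifying coloring only involves walks of length three in one
digraph and of length two in the other, so it is a finite check on `F`, independent of `m` and `n`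
(`lidColorable_of_table`). The digraph `0 → 1 → ⋯ → t + 1 → 0` with the additional arc
`t + 1 → t`, for odd `t`, has closed walks of every even positive length and of every odd length
above `t` (`exists_lassoWalk`): `t = 3` serves all `m, n ≥ 4` with one table of four colors.
-/

namespace LidColoring

open SimpleGraph

/-! ### The least number of colors -/

theorem lidChromaticNumber_eq {V : Type*} {G : SimpleGraph V} {k : ℕ} (hk : LidColorable G k)
    (hmin : ∀ l, LidColorable G l → k ≤ l) : lidChromaticNumber G = k := by
  refine le_antisymm (iInf₂_le k hk) (le_iInf₂ fun l hl => ?_)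
  exact_mod_cast hmin l hl

/-! ### Lower bounds -/

/-- Adjacent vertices of `G` have distinct closed neighborhoods. -/
def TwinFree {V : Type*} (G : SimpleGraph V) : Prop :=
  ∀ u v, G.Adj u v → closedNeighborSet G u ≠ closedNeighborSet G v

theorem twinFree_boxProd {V W : Type*} {G : SimpleGraph V} {H : SimpleGraph W}
    (hG : ∀ a, ∃ a', G.Adj a a') (hH : ∀ b, ∃ b', H.Adj b b') : TwinFree (G □ H) := by
  rintro ⟨a, b⟩ ⟨c, d⟩ hadj heq
  rw [boxProd_adj] at hadj
  rcases hadj with ⟨hac, rfl : b = d⟩ | ⟨hbd, rfl : a = c⟩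
  · -- A neighbor of the first endpoint in the other factor is at distance two from the second.
    obtain ⟨b', hb'⟩ := hH b
    have hmem : (a, b') ∈ closedNeighborSet (G □ H) (c, b) := by
      rw [← heq]
      simp [closedNeighborSet, hb']
    simp [closedNeighborSet, hac.ne, hac.ne', hb'.ne, hb'.ne'] at hmem
  · obtain ⟨a', ha'⟩ := hG a
    have hmem : (a', b) ∈ closedNeighborSet (G □ H) (a, d) := by
      rw [← heq]
      simp [closedNeighborSet, ha']
    simp [closedNeighborSet, hbd.ne, hbd.ne', ha'.ne, ha'.ne'] at hmem

/-- The vertices of a clique see pairwise distinct subsets of the colors that do not occur in the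
clique. -/
theorem card_le_two_pow_of_isClique {V : Type*} {G : SimpleGraph V} {k : ℕ} (hG : TwinFree G)
    (hk : LidColorable G k) {s : Finset V} (hs : G.IsClique (s : Set V)) :
    s.card ≤ 2 ^ (k - s.card) := by
  classical
  obtain ⟨C, hC⟩ := hk
  have hinj : Set.InjOn C s := fun u hu v hv h => by
    by_contra hne
    exact C.valid (hs hu hv hne) h
  have hcard : ((s.image C)ᶜ.powerset).card = 2 ^ (k - s.card) := by
    rw [Finset.card_powerset, Finset.card_compl, Fintype.card_fin, Finset.card_image_of_injOn hinj]
  rw [← hcard]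
  refine Finset.card_le_card_of_injOn
    (fun v => (s.image C)ᶜ.filter (· ∈ C '' closedNeighborSet G v))
    (fun v _ => Finset.mem_powerset.2 (Finset.filter_subset _ _)) fun u hu v hv huv => ?_
  by_contra hne
  refine hC u v (hs hu hv hne) (hG u v (hs hu hv hne)) ?_
  have hsub : ∀ w ∈ s, ∀ c ∈ s.image C, c ∈ C '' closedNeighborSet G w := by
    intro w hw c hc
    obtain ⟨x, hx, rfl⟩ := Finset.mem_image.1 hc
    refine ⟨x, ?_, rfl⟩
    by_cases hxw : x = w
    · exact Or.inl hxw
    · exact Or.inr (hs hw hx (Ne.symm hxw))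
  ext c
  by_cases hc : c ∈ s.image C
  · exact iff_of_true (hsub u hu c hc) (hsub v hv c hc)
  · have := Finset.ext_iff.1 huv c
    simp only [Finset.mem_filter, Finset.mem_compl, hc, not_false_eq_true, true_and] at this
    exact this

theorem three_le_of_lidColorable {V : Type*} {G : SimpleGraph V} {k : ℕ} (hG : TwinFree G)
    (hk : LidColorable G k) {u v : V} (huv : G.Adj u v) : 3 ≤ k := by
  classical
  have hs : G.IsClique (({u, v} : Finset V) : Set V) := by
    simpa using fun _ => huv
  have h := card_le_two_pow_of_isClique hG hk hs
  rw [Finset.card_pair huv.ne] at h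
  by_contra hlt
  rw [show k - 2 = 0 by omega] at h
  omega

theorem five_le_of_lidColorable {V : Type*} {G : SimpleGraph V} {k : ℕ} (hG : TwinFree G)
    (hk : LidColorable G k) {s : Finset V} (hs : G.IsNClique 3 s) : 5 ≤ k := by
  have h := card_le_two_pow_of_isClique hG hk hs.isClique
  rw [hs.card_eq] at h
  by_contra hlt
  have : 2 ^ (k - 3) ≤ 2 ^ 1 := Nat.pow_le_pow_right (by omega) (by omega)
  omega

/-- With three colors, the closed neighborhoods of the two ends of an edge cannot both see all
colors, nor both see only the two colors of the edge. -/
theorem colorable_two_of_lidColorable_three {V : Type*} {G : SimpleGraph V} (hG : TwinFree G)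
    (hk : LidColorable G 3) : G.Colorable 2 := by
  classical
  obtain ⟨C, hC⟩ := hk
  let D : G.Coloring Bool :=
    Coloring.mk (fun v => decide (C '' closedNeighborSet G v = Set.univ)) (by
      intro u v huv h
      rw [decide_eq_decide] at h
      refine hC u v huv (hG u v huv) ?_
      by_cases hu : C '' closedNeighborSet G u = Set.univ
      · rw [hu, h.1 hu]
      have hv := mt h.2 hu
      have huu : C u ∈ C '' closedNeighborSet G u := ⟨u, Or.inl rfl, rfl⟩
      have huv' : C v ∈ C '' closedNeighborSet G u := ⟨v, Or.inr huv, rfl⟩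
      have hvv : C v ∈ C '' closedNeighborSet G v := ⟨v, Or.inl rfl, rfl⟩
      have hvu : C u ∈ C '' closedNeighborSet G v := ⟨u, Or.inr huv.symm, rfl⟩
      have hne := C.valid huv
      generalize C '' closedNeighborSet G u = S at *
      generalize C '' closedNeighborSet G v = T at *
      obtain ⟨c, hc⟩ := (Set.ne_univ_iff_exists_notMem S).1 hu
      obtain ⟨d, hd⟩ := (Set.ne_univ_iff_exists_notMem T).1 hv
      have key : ∀ x y c z : Fin 3, x ≠ y → c ≠ x → c ≠ y → z = x ∨ z = y ∨ z = c := by decide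
      have hcx : c ≠ C u := fun e => hc (e ▸ huu)
      have hcy : c ≠ C v := fun e => hc (e ▸ huv')
      have hdc : d = c := by
        rcases key (C u) (C v) c d hne hcx hcy with rfl | rfl | rfl
        · exact absurd hvu hd
        · exact absurd hvv hd
        · rfl
      subst hdc
      ext z
      rcases key (C u) (C v) d z hne hcx hcy with rfl | rfl | rfl
      · exact iff_of_true huu hvu
      · exact iff_of_true huv' hvv
      · exact iff_of_false hc hd)
  simpa using D.colorable

/-! ### Colorings from tables -/

/-- The colors that the table `F` shows at row `b`, column `y`, with neighboring rows `a`, `c` and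
neighboring columns `x`, `z`. -/
def crossColors {A B : Type*} {k : ℕ} (F : A → B → Fin k) (a b c : A) (x y z : B) :
    Finset (Fin k) :=
  {F b y, F a y, F c y, F b x, F b z}

theorem closedNeighborSet_boxProd_cycleGraph {m n : ℕ} (i : Fin (m + 2)) (j : Fin (n + 2)) :
    closedNeighborSet (cycleGraph (m + 2) □ cycleGraph (n + 2)) (i, j) =
      {(i, j), (i - 1, j), (i + 1, j), (i, j - 1), (i, j + 1)} := by
  ext ⟨a, b⟩
  simp only [closedNeighborSet, Set.mem_insert_iff, mem_neighborSet, boxProd_adj, cycleGraph_adj,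
    Set.mem_singleton_iff, Prod.mk.injEq]
  have h1 : i - a = 1 ↔ a = i - 1 :=
    ⟨fun h => by rw [← h, sub_sub_cancel], fun h => by rw [h, sub_sub_cancel]⟩
  have h2 : j - b = 1 ↔ b = j - 1 :=
    ⟨fun h => by rw [← h, sub_sub_cancel], fun h => by rw [h, sub_sub_cancel]⟩
  rw [h1, h2, sub_eq_iff_eq_add', sub_eq_iff_eq_add', eq_comm (a := i) (b := a),
    eq_comm (a := j) (b := b)]
  tauto

/-- If `F` looks locally like a locally identifying coloring along all walks of the digraphs `R` and
`S`, then it yields such a coloring of every product of two cycles that are closed walks in `R` and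
`S`. -/
theorem lidColorable_of_table {m n k : ℕ} {A B : Type*} {R : A → A → Prop} {S : B → B → Prop}
    {σ : Fin (m + 2) → A} {τ : Fin (n + 2) → B} (hσ : ∀ i, R (σ i) (σ (i + 1)))
    (hτ : ∀ j, S (τ j) (τ (j + 1))) (F : A → B → Fin k)
    (hrow : ∀ a b, R a b → ∀ c, R b c → ∀ d, R c d → ∀ x y, S x y → ∀ z, S y z →
      F b y ≠ F c y ∧ crossColors F a b c x y z ≠ crossColors F b c d x y z)
    (hcol : ∀ x y, S x y → ∀ z, S y z → ∀ w, S z w → ∀ a b, R a b → ∀ c, R b c →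
      F b y ≠ F b z ∧ crossColors F a b c x y z ≠ crossColors F a b c y z w) :
    LidColorable (cycleGraph (m + 2) □ cycleGraph (n + 2)) k := by
  have hσ' : ∀ i, R (σ (i - 1)) (σ i) := fun i => by simpa using hσ (i - 1)
  have hτ' : ∀ j, S (τ (j - 1)) (τ j) := fun j => by simpa using hτ (j - 1)
  let f : Fin (m + 2) × Fin (n + 2) → Fin k := fun p => F (σ p.1) (τ p.2)
  have himage : ∀ i j, f '' closedNeighborSet (cycleGraph (m + 2) □ cycleGraph (n + 2)) (i, j) =
      crossColors F (σ (i - 1)) (σ i) (σ (i + 1)) (τ (j - 1)) (τ j) (τ (j + 1)) := fun i j => by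
    rw [closedNeighborSet_boxProd_cycleGraph]
    simp [f, crossColors, Set.image_insert_eq]
  have hedge : ∀ u v, (cycleGraph (m + 2) □ cycleGraph (n + 2)).Adj u v → f u ≠ f v ∧
      f '' closedNeighborSet (cycleGraph (m + 2) □ cycleGraph (n + 2)) u ≠
        f '' closedNeighborSet (cycleGraph (m + 2) □ cycleGraph (n + 2)) v := by
    have hrow' : ∀ i j, f (i, j) ≠ f (i + 1, j) ∧
        f '' closedNeighborSet (cycleGraph (m + 2) □ cycleGraph (n + 2)) (i, j) ≠
          f '' closedNeighborSet (cycleGraph (m + 2) □ cycleGraph (n + 2)) (i + 1, j) := by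
      intro i j
      rw [himage, himage, Ne, Ne, Finset.coe_inj, add_sub_cancel_right]
      exact hrow _ _ (hσ' i) _ (hσ i) _ (hσ (i + 1)) _ _ (hτ' j) _ (hτ j)
    have hcol' : ∀ i j, f (i, j) ≠ f (i, j + 1) ∧
        f '' closedNeighborSet (cycleGraph (m + 2) □ cycleGraph (n + 2)) (i, j) ≠
          f '' closedNeighborSet (cycleGraph (m + 2) □ cycleGraph (n + 2)) (i, j + 1) := by
      intro i j
      rw [himage, himage, Ne, Ne, Finset.coe_inj, add_sub_cancel_right]
      exact hcol _ _ (hτ' j) _ (hτ j) _ (hτ (j + 1)) _ _ (hσ' i) _ (hσ i)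
    rintro ⟨i, j⟩ ⟨i', j'⟩ h
    rw [boxProd_adj, cycleGraph_adj, cycleGraph_adj] at h
    rcases h with ⟨h | h, rfl : j = j'⟩ | ⟨h | h, rfl : i = i'⟩
    · obtain rfl : i = i' + 1 := sub_eq_iff_eq_add'.1 h
      exact ⟨(hrow' i' j).1.symm, (hrow' i' j).2.symm⟩
    · obtain rfl : i' = i + 1 := sub_eq_iff_eq_add'.1 h
      exact hrow' i j
    · obtain rfl : j = j' + 1 := sub_eq_iff_eq_add'.1 h
      exact ⟨(hcol' i j').1.symm, (hcol' i j').2.symm⟩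
    · obtain rfl : j' = j + 1 := sub_eq_iff_eq_add'.1 h
      exact hcol' i j
  exact ⟨Coloring.mk f fun {u v} h => (hedge u v h).1, fun u v h _ => (hedge u v h).2⟩

/-! ### Closed walks -/

/-- The directed cycle on `Fin (t + 2)` with the last arc `t → t + 1` made bidirectional. -/
def Lasso (t : ℕ) (a b : Fin (t + 2)) : Prop :=
  b = a + 1 ∨ (a.val = t + 1 ∧ b.val = t)

instance (t : ℕ) : DecidableRel (Lasso t) := fun _ _ => inferInstanceAs (Decidable (_ ∨ _))

/-- Even closed walks alternate between `t` and `t + 1`; odd ones go around the directed cycle once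
and spend the excess length on this alternation. -/
theorem exists_lassoWalk {t n : ℕ} (ht : Odd t) (hn : Odd (n + 2) → t ≤ n + 1) :
    ∃ σ : Fin (n + 2) → Fin (t + 2), ∀ i, Lasso t (σ i) (σ (i + 1)) := by
  -- An arc of `Lasso t` in terms of the underlying natural numbers.
  have harc : ∀ a b : Fin (t + 2), (b.val = a.val + 1 ∨ (a.val = t + 1 ∧ b.val = 0) ∨
      (a.val = t + 1 ∧ b.val = t)) → Lasso t a b := by
    intro a b h
    rcases h with h | h | h
    · refine Or.inl (Fin.ext ?_)
      rw [Fin.val_add_one_of_lt' (by omega), h]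
    · refine Or.inl (Fin.ext ?_)
      rw [show a = Fin.last (t + 1) from Fin.ext h.1, h.2]
      simp
    · exact Or.inr h
  obtain ⟨r, rfl⟩ := ht
  have hsucc : ∀ i : Fin (n + 2), (i.val < n + 1 ∧ (i + 1).val = i.val + 1) ∨
      (i.val = n + 1 ∧ (i + 1).val = 0) := by
    intro i
    rcases Nat.lt_or_ge i.val (n + 1) with h | h
    · exact Or.inl ⟨h, Fin.val_add_one_of_lt' (by omega)⟩
    · have : i = Fin.last (n + 1) := Fin.ext (by have := i.isLt; simp; omega)
      subst this
      simp
  rcases Nat.even_or_odd (n + 2) with he | ho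
  · obtain ⟨s, hs⟩ := he
    refine ⟨fun i => ⟨2 * r + 1 + i.val % 2, by omega⟩, fun i => harc _ _ ?_⟩
    have := hsucc i
    simp only
    omega
  · have hle := hn ho
    obtain ⟨s, hs⟩ := ho
    refine ⟨fun i => ⟨if i.val < 2 * r + 1 then i.val else 2 * r + 1 + (i.val - (2 * r + 1)) % 2,
      by split_ifs <;> omega⟩, fun i => harc _ _ ?_⟩
    have := hsucc i
    simp only
    split_ifs <;> omega

/-! ### The optimal colorings -/

theorem lidColorable_three_of_even {m n : ℕ} (hm : Even (m + 2)) (hn : Even (n + 2)) :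
    LidColorable (cycleGraph (m + 2) □ cycleGraph (n + 2)) 3 := by
  have hstep : ∀ {l : ℕ}, Even (l + 2) → ∃ σ : Fin (l + 2) → Bool, ∀ i, σ i ≠ σ (i + 1) := by
    intro l hl
    refine ⟨cycleGraph.bicoloring_of_even (l + 2) hl, fun i => ?_⟩
    exact (cycleGraph.bicoloring_of_even (l + 2) hl).valid (cycleGraph_adj.2 (Or.inr (by simp)))
  obtain ⟨σ, hσ⟩ := hstep hm
  obtain ⟨τ, hτ⟩ := hstep hn
  -- One side of the bipartition is constant; the other takes the two remaining colors in
  -- alternate rows.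
  refine lidColorable_of_table hσ hτ (fun a b => if a = b then 0 else if a then 1 else 2) ?_ ?_
  · decide
  · decide

theorem lidColorable_four {m n : ℕ} (hm : 4 ≤ m + 2) (hn : 4 ≤ n + 2) :
    LidColorable (cycleGraph (m + 2) □ cycleGraph (n + 2)) 4 := by
  obtain ⟨σ, hσ⟩ := exists_lassoWalk (t := 3) (n := m) (by decide) (fun ⟨r, hr⟩ => by omega)
  obtain ⟨τ, hτ⟩ := exists_lassoWalk (t := 3) (n := n) (by decide) (fun ⟨r, hr⟩ => by omega)
  refine lidColorable_of_table hσ hτ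
    ![![3, 0, 2, 3, 0], ![0, 1, 3, 1, 2], ![2, 3, 0, 3, 0], ![3, 2, 3, 0, 1], ![0, 1, 0, 2, 3]]
    ?_ ?_
  · decide +kernel
  · decide +kernel

theorem lidColorable_five {n : ℕ} (hn : 3 ≤ n + 2) :
    LidColorable (cycleGraph 3 □ cycleGraph (n + 2)) 5 := by
  obtain ⟨τ, hτ⟩ := exists_lassoWalk (t := 1) (n := n) (by decide) (fun _ => by omega)
  refine lidColorable_of_table (m := 1) (R := fun a b : Fin 3 => b = a + 1) (σ := id)
    (fun _ => rfl) hτ ![![4, 2, 0], ![0, 4, 3], ![3, 0, 1]] ?_ ?_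
  · decide +kernel
  · decide +kernel

end LidColoring

open LidColoring SimpleGraph in
theorem mainTheorem4 (m n : ℕ) (hm : 3 ≤ m) (hmn : m ≤ n) :
    LidColoring.lidChromaticNumber
        (SimpleGraph.boxProd (SimpleGraph.cycleGraph m) (SimpleGraph.cycleGraph n)) =
      if m = 3 then 5 else if Even m ∧ Even n then 3 else 4 := by
  obtain ⟨p, rfl⟩ : ∃ p, m = p + 2 := ⟨m - 2, by omega⟩
  obtain ⟨q, rfl⟩ : ∃ q, n = q + 2 := ⟨n - 2, by omega⟩
  have hnext : ∀ {l : ℕ} (i : Fin (l + 2)), (cycleGraph (l + 2)).Adj i (i + 1) :=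
    fun i => cycleGraph_adj.2 (Or.inr (by simp))
  have htwin : TwinFree (cycleGraph (p + 2) □ cycleGraph (q + 2)) :=
    twinFree_boxProd (fun i => ⟨i + 1, hnext i⟩) (fun j => ⟨j + 1, hnext j⟩)
  have hthree : ∀ k, LidColorable (cycleGraph (p + 2) □ cycleGraph (q + 2)) k → 3 ≤ k :=
    fun k hk => three_le_of_lidColorable htwin hk
      (boxProd_adj.2 (Or.inl ⟨hnext 0, rfl⟩) :
        (cycleGraph (p + 2) □ cycleGraph (q + 2)).Adj (0, 0) (0 + 1, 0))
  split_ifs with h3 heven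
  · obtain rfl : p = 1 := by omega
    refine lidChromaticNumber_eq (k := 5) (lidColorable_five (by omega)) fun k hk => ?_
    have htri : (cycleGraph (1 + 2)).IsNClique 3 Finset.univ := by
      rw [show cycleGraph (1 + 2) = ⊤ from cycleGraph_three_eq_top]
      exact ⟨fun _ _ _ _ h => h, rfl⟩
    have hmap :=
      htri.map (f := (boxProdLeft (cycleGraph (1 + 2)) (cycleGraph (q + 2)) 0).toEmbedding)
    refine five_le_of_lidColorable htwin hk (hmap.mono ?_)
    rintro _ _ ⟨-, a, b, h, rfl, rfl⟩
    exact boxProd_adj_left.2 h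
  · exact lidChromaticNumber_eq (k := 3) (lidColorable_three_of_even heven.1 heven.2) hthree
  · refine lidChromaticNumber_eq (k := 4) (lidColorable_four (by omega) (by omega)) fun k hk => ?_
    have hk3 := hthree k hk
    by_contra hlt
    obtain rfl : k = 3 := by omega
    have hbip := colorable_two_of_lidColorable_three htwin hk
    have hodd : ∀ l : ℕ, (cycleGraph (l + 2)).Colorable 2 → Even (l + 2) := by
      intro l hl
      by_contra ho
      have hle := hl.chromaticNumber_le
      rw [chromaticNumber_cycleGraph_of_odd _ (by omega) (Nat.not_even_iff_odd.1 ho)] at hle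
      exact absurd hle (by decide)
    exact heven ⟨hodd p (hbip.of_hom (boxProdLeft _ _ 0).toHom),
      hodd q (hbip.of_hom (boxProdRight _ _ 0).toHom)⟩
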